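/- For a nonempty closed convex set $X\subseteq\mathbb{R}^d$ let $\Pi_X(v)=\arg\min_{z\in X}\|v-z\|_2^2$ be the Euclidean projection. Let $\mathbb{PP}_d=\mathrm{conv}\{e\in\{0,1\}^d:\|e\|_1\text{ even}\}$ be the parity polytope and $\mathbb{S}_d=\{x\in\mathbb{R}^d:\sum_i x_i=1,\ x_i\ge 0 \text{ for all } i\}$ the probability simplex. For $f\in\{0,1\}^d$ let $T_f:\mathbb{R}^d\to\mathbb{R}^d$ be given by $T_f(v)_i=1-v_i$ if $f_i=1$ and $T_f(v)_i=v_i$ if $f_i=0$. Consider the following algorithm with input $v\in\mathbb{R}^d$. Put $\hat v=\Pi_{[0,1]^d}(v)$, and let $f_i=1$ if $\hat v_i>\tfrac12$ and $f_i=0$ otherwise. If $\sum_i f_i$ is even, choose $i^\ast\in\arg\min_i|\tfrac12-\hat v_i|$ (ties are broken arbitrarily) and replace $f_{i^\ast}$ by $1-f_{i^\ast}$. If $\sum_i\Pi_{[0,1]^d}(T_f(v))_i\ge 1$, return $\hat v$; otherwise return $T_f(\Pi_{\mathbb{S}_d}(T_f(v)))$. Theorem. Let $v\in\mathbb{R}^d$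 be such that $\Pi_{[0,1]^d}(v)\notin\mathbb{PP}_d$, and let $f\in\{0,1\}^d$ be the vector calculated by the algorithm. Then $$\Pi_{\mathbb{PP}_d}(v)=T_f\bigl(\Pi_{\mathbb{S}_d}(T_f(v))\bigr),$$ and the algorithm returns $\Pi_{\mathbb{PP}_d}(v)$. -/

import Mathlib

namespace ParityPolytope

/-- `p` is a minimizer over `X` of the Euclidean distance to `v`. -/
def IsProj {d : ℕ} (X : Set (EuclideanSpace ℝ (Fin d))) (v p : EuclideanSpace ℝ (Fin d)) : Prop :=
  p ∈ X ∧ ∀ z ∈ X, ‖v - p‖ ^ 2 ≤ ‖v - z‖ ^ 2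

/-- Euclidean projection of `v` onto `X`, the argmin of `‖v - z‖ ^ 2` over `z ∈ X`. It is well
defined for nonempty closed convex `X`, see `existsUnique_isProj` and `isProj_iff`. -/
noncomputable def proj {d : ℕ} (X : Set (EuclideanSpace ℝ (Fin d)))
    (v : EuclideanSpace ℝ (Fin d)) : EuclideanSpace ℝ (Fin d) :=
  Classical.epsilon (IsProj X v)

/-- The unit cube `[0,1]^d`. -/
def cube (d : ℕ) : Set (EuclideanSpace ℝ (Fin d)) :=
  {x | ∀ i, 0 ≤ x i ∧ x i ≤ 1}

/-- The probability simplex: nonnegative vectors whose components sum to one. -/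
def simplex (d : ℕ) : Set (EuclideanSpace ℝ (Fin d)) :=
  {x | ∑ i, x i = 1 ∧ ∀ i, 0 ≤ x i}

/-- A binary vector viewed as a real vector. -/
noncomputable def binVec {d : ℕ} (b : Fin d → Fin 2) : EuclideanSpace ℝ (Fin d) :=
  WithLp.toLp 2 fun i => ((b i : ℕ) : ℝ)

/-- The weight (number of ones) of a binary vector. -/
def weight {d : ℕ} (b : Fin d → Fin 2) : ℕ := ∑ i, (b i : ℕ)

/-- The parity polytope: convex hull of the vertices of the unit cube of even weight. -/
def parityPolytope (d : ℕ) : Set (EuclideanSpace ℝ (Fin d)) :=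
  convexHull ℝ (binVec '' {b : Fin d → Fin 2 | Even (weight b)})

/-- The map `T_f`, replacing `v i` by `1 - v i` at those `i` where `f i = 1`. -/
noncomputable def flip {d : ℕ} (f : Fin d → Fin 2) (v : EuclideanSpace ℝ (Fin d)) :
    EuclideanSpace ℝ (Fin d) :=
  WithLp.toLp 2 fun i => if f i = 1 then 1 - v i else v i

/-- Componentwise thresholding at `1/2`. -/
noncomputable def threshold {d : ℕ} (x : EuclideanSpace ℝ (Fin d)) : Fin d → Fin 2 :=
  fun i => if x i > 1 / 2 then 1 else 0

/-- `f` is a binary vector that the algorithm may compute from the input `v`: threshold the box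
projection of `v` at `1/2`; if the result has even weight, flip its entry at an index `j` at which
the box projection is closest to `1/2` (any such `j` is allowed). -/
def IsFacetVector {d : ℕ} (v : EuclideanSpace ℝ (Fin d)) (f : Fin d → Fin 2) : Prop :=
  (Odd (weight (threshold (proj (cube d) v))) ∧ f = threshold (proj (cube d) v)) ∨
  (Even (weight (threshold (proj (cube d) v))) ∧
    ∃ j : Fin d, (∀ i, |1 / 2 - proj (cube d) v j| ≤ |1 / 2 - proj (cube d) v i|) ∧
      f = Function.update (threshold (proj (cube d) v)) j (1 - threshold (proj (cube d) v) j))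

open Classical in
/-- The output of the algorithm on input `v`, when `f` is the binary vector it has computed. -/
noncomputable def algorithmOutput {d : ℕ} (v : EuclideanSpace ℝ (Fin d)) (f : Fin d → Fin 2) :
    EuclideanSpace ℝ (Fin d) :=
  if 1 ≤ ∑ i, proj (cube d) (flip f v) i then proj (cube d) v
  else flip f (proj (simplex d) (flip f v))

/-- Projections onto nonempty closed convex sets exist and are unique. -/
theorem existsUnique_isProj {d : ℕ} {X : Set (EuclideanSpace ℝ (Fin d))} (hne : X.Nonempty)
    (hcl : IsClosed X) (hco : Convex ℝ X) (v : EuclideanSpace ℝ (Fin d)) :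
    ∃! p, IsProj X v p := by
  have key : ∀ p ∈ X, IsProj X v p → ∀ z ∈ X, inner ℝ (v - p) (z - p) ≤ 0 := by
    intro p hp h
    refine (norm_eq_iInf_iff_real_inner_le_zero hco hp).1 ?_
    have : Nonempty X := ⟨⟨p, hp⟩⟩
    refine le_antisymm (le_ciInf fun z => ?_)
      (ciInf_le (f := fun w : X => ‖v - w‖) ⟨0, ?_⟩ ⟨p, hp⟩)
    · exact le_of_sq_le_sq (h.2 z z.2) (norm_nonneg _)
    · rintro _ ⟨w, rfl⟩
      exact norm_nonneg _
  obtain ⟨p, hp, h⟩ := exists_norm_eq_iInf_of_complete_convex hne hcl.isComplete hco v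
  have hpP : IsProj X v p := by
    refine ⟨hp, fun z hz => ?_⟩
    have : ‖v - p‖ ≤ ‖v - z‖ := by
      rw [h]
      refine ciInf_le (f := fun w : X => ‖v - w‖) ⟨0, ?_⟩ ⟨z, hz⟩
      rintro _ ⟨w, rfl⟩
      exact norm_nonneg _
    gcongr
  refine ⟨p, hpP, fun q hq => ?_⟩
  have h1 := key p hp hpP q hq.1
  have h2 := key q hq.1 hq p hp
  have h3 : inner ℝ (q - p) (q - p) = inner ℝ (v - p) (q - p) + inner ℝ (v - q) (p - q) := by
    rw [← neg_sub q p, inner_neg_right, ← sub_eq_add_neg, ← inner_sub_left]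
    congr 1
    abel
  have h4 : inner ℝ (q - p) (q - p) = 0 :=
    le_antisymm (h3 ▸ add_nonpos h1 h2) real_inner_self_nonneg
  exact sub_eq_zero.1 (inner_self_eq_zero.1 h4)

theorem isProj_iff {d : ℕ} {X : Set (EuclideanSpace ℝ (Fin d))} (hne : X.Nonempty)
    (hcl : IsClosed X) (hco : Convex ℝ X) (v p : EuclideanSpace ℝ (Fin d)) :
    IsProj X v p ↔ proj X v = p := by
  have hu := existsUnique_isProj hne hcl hco v
  have hs : IsProj X v (proj X v) := Classical.epsilon_spec hu.exists
  exact ⟨fun h => hu.unique hs h, fun h => h ▸ hs⟩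

/-- The cube, the parity polytope and (in positive dimension) the simplex are nonempty, closed and
convex, so projection onto each of them is well defined. -/
theorem cube_wellDefined (d : ℕ) :
    (cube d).Nonempty ∧ IsClosed (cube d) ∧ Convex ℝ (cube d) := by
  refine ⟨⟨0, fun i => by simp⟩, ?_, ?_⟩
  · simp only [cube, Set.ofPred_forall]
    refine isClosed_iInter fun i => IsClosed.and ?_ ?_
    · exact isClosed_le (by fun_prop) (by fun_prop)
    · exact isClosed_le (by fun_prop) (by fun_prop)
  · intro x hx y hy a b ha hb hab i
    have hxi := hx i
    have hyi := hy i
    simp only [PiLp.add_apply, PiLp.smul_apply, smul_eq_mul]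
    constructor <;> nlinarith

theorem simplex_wellDefined (d : ℕ) (hd : 0 < d) :
    (simplex d).Nonempty ∧ IsClosed (simplex d) ∧ Convex ℝ (simplex d) := by
  refine ⟨⟨EuclideanSpace.single ⟨0, hd⟩ 1, ?_, fun i => ?_⟩, ?_, ?_⟩
  · simp
  · simp only [PiLp.single_apply]
    split_ifs <;> norm_num
  · refine IsClosed.and (isClosed_eq (by fun_prop) (by fun_prop)) ?_
    simp only [Set.ofPred_forall]
    exact isClosed_iInter fun i => isClosed_le (by fun_prop) (by fun_prop)
  · intro x hx y hy a b ha hb hab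
    refine ⟨?_, fun i => ?_⟩
    · simp only [PiLp.add_apply, PiLp.smul_apply, smul_eq_mul, Finset.sum_add_distrib,
        ← Finset.mul_sum, hx.1, hy.1]
      linarith
    · have hxi := hx.2 i
      have hyi := hy.2 i
      simp only [PiLp.add_apply, PiLp.smul_apply, smul_eq_mul]
      positivity

theorem parityPolytope_wellDefined (d : ℕ) :
    (parityPolytope d).Nonempty ∧ IsClosed (parityPolytope d) ∧
      Convex ℝ (parityPolytope d) := by
  refine ⟨⟨binVec 0, subset_convexHull ℝ _ ⟨0, by simp [weight], rfl⟩⟩, ?_, convex_convexHull ℝ _⟩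
  exact ((Set.toFinite _).isCompact_convexHull ℝ).isClosed

end ParityPolytope

namespace ParityPolytope

variable {d : ℕ}

/-! For odd `f`, `flip f` is an isometric involution of the cube that sends the parity polytope into
the region of cube points with coordinate sum at least one. Conversely, a cube point of that region
whose pairwise sums are at most one flips back into the polytope (`flip_mem_parityPolytope`). The
algorithm's `f` gives the flipped box projection such pairwise sums, so if the box projection is
outside the polytope, its flip has sum below one. Then the simplex projection is at least as close
as any point of the region (`norm_sub_proj_simplex_le`). As the simplex also flips into the
polytope, flipping back gives the projection. -/

theorem fin_two_eq_one_of_ne_zero {a : Fin 2} (h : a ≠ 0) : a = 1 := by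
  revert h; revert a; decide

theorem binVec_apply (b : Fin d → Fin 2) (i : Fin d) : binVec b i = ((b i : ℕ) : ℝ) := rfl

/-! ### Flips as isometries of the cube -/

theorem flip_apply (f : Fin d → Fin 2) (v : EuclideanSpace ℝ (Fin d)) (i : Fin d) :
    flip f v i = if f i = 1 then 1 - v i else v i := rfl

theorem flip_flip (f : Fin d → Fin 2) (v : EuclideanSpace ℝ (Fin d)) :
    flip f (flip f v) = v := by
  ext i
  simp only [flip_apply]
  split_ifs <;> ring

/-- Where two binary vectors differ, their flips sum to one. -/
theorem flip_apply_of_ne {b f : Fin d → Fin 2} {i : Fin d} (h : b i ≠ f i)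
    (v : EuclideanSpace ℝ (Fin d)) : flip b v i = 1 - flip f v i := by
  simp only [flip_apply]
  by_cases hb : b i = 1 <;> by_cases hf : f i = 1
  · exact absurd (hb.trans hf.symm) h
  · simp [hb, hf]
  · simp [hb, hf]
  · have hb0 : b i = 0 := by by_contra h0; exact hb (fin_two_eq_one_of_ne_zero h0)
    have hf0 : f i = 0 := by by_contra h0; exact hf (fin_two_eq_one_of_ne_zero h0)
    exact absurd (hb0.trans hf0.symm) h

theorem norm_flip_sub_flip (f : Fin d → Fin 2) (v w : EuclideanSpace ℝ (Fin d)) :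
    ‖flip f v - flip f w‖ = ‖v - w‖ := by
  rw [EuclideanSpace.norm_eq, EuclideanSpace.norm_eq]
  congr 1
  refine Finset.sum_congr rfl fun i _ => ?_
  simp only [PiLp.sub_apply, flip_apply, Real.norm_eq_abs, sq_abs]
  split_ifs <;> ring

theorem flip_convexCombo (f : Fin d → Fin 2) (x y : EuclideanSpace ℝ (Fin d)) {a b : ℝ}
    (hab : a + b = 1) : flip f (a • x + b • y) = a • flip f x + b • flip f y := by
  ext i
  simp only [flip_apply, PiLp.add_apply, PiLp.smul_apply, smul_eq_mul]
  split_ifs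
  · linear_combination -hab
  · rfl

theorem flip_mem_cube (f : Fin d → Fin 2) {x : EuclideanSpace ℝ (Fin d)} (hx : x ∈ cube d) :
    flip f x ∈ cube d := by
  intro i
  have := hx i
  rw [flip_apply]
  split_ifs <;> constructor <;> linarith

theorem isProj_proj_cube (v : EuclideanSpace ℝ (Fin d)) : IsProj (cube d) v (proj (cube d) v) := by
  obtain ⟨h1, h2, h3⟩ := cube_wellDefined d
  exact (isProj_iff h1 h2 h3 v _).2 rfl

theorem proj_cube_flip (f : Fin d → Fin 2) (v : EuclideanSpace ℝ (Fin d)) :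
    proj (cube d) (flip f v) = flip f (proj (cube d) v) := by
  obtain ⟨h1, h2, h3⟩ := cube_wellDefined d
  refine (isProj_iff h1 h2 h3 _ _).1 ⟨flip_mem_cube f (isProj_proj_cube v).1, fun z hz => ?_⟩
  rw [norm_flip_sub_flip, ← flip_flip f z, norm_flip_sub_flip]
  exact (isProj_proj_cube v).2 _ (flip_mem_cube f hz)

/-! ### Parity and membership in the parity polytope -/

theorem even_weight_update (b : Fin d → Fin 2) (k : Fin d) :
    Even (weight (Function.update b k (1 - b k))) ↔ Odd (weight b) := by
  have h1 : weight b = (b k : ℕ) + ∑ i ∈ Finset.univ.erase k, (b i : ℕ) :=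
    (Finset.add_sum_erase _ (fun i => (b i : ℕ)) (Finset.mem_univ k)).symm
  have h2 : weight (Function.update b k (1 - b k)) =
      ((1 - b k : Fin 2) : ℕ) + ∑ i ∈ Finset.univ.erase k, (b i : ℕ) := by
    rw [weight, ← Finset.add_sum_erase _ _ (Finset.mem_univ k), Function.update_self]
    congr 1
    refine Finset.sum_congr rfl fun i hi => ?_
    rw [Function.update_of_ne (Finset.ne_of_mem_erase hi)]
  rw [h1, h2]
  by_cases hb : b k = 0
  · simp [hb, Nat.even_add]
  · simp [fin_two_eq_one_of_ne_zero hb, Nat.odd_add]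

/-- Distinct binary vectors of odd weight differ in at least two places. -/
theorem exists_two_ne_of_odd {b f : Fin d → Fin 2} (hb : Odd (weight b)) (hf : Odd (weight f))
    (h : b ≠ f) : ∃ i k, i ≠ k ∧ b i ≠ f i ∧ b k ≠ f k := by
  obtain ⟨i, hi⟩ := Function.ne_iff.1 h
  by_contra! hcon
  have : b = Function.update f i (1 - f i) := by
    funext k
    by_cases hk : k = i
    · subst hk
      rw [Function.update_self]
      generalize b k = s at hi
      generalize f k = t at hi
      revert hi; revert s t; decide
    · rw [Function.update_of_ne hk]
      exact hcon i k (Ne.symm hk) hi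
  rw [← Nat.not_even_iff_odd, this, even_weight_update] at hb
  exact hb hf

/-- An even vertex differs from the odd `f` somewhere, and its flip equals 1 there; convexity
extends the bound to the hull. -/
theorem one_le_sum_flip_of_mem_parityPolytope {f : Fin d → Fin 2} (hf : Odd (weight f))
    {z : EuclideanSpace ℝ (Fin d)} (hz : z ∈ parityPolytope d) :
    z ∈ cube d ∧ 1 ≤ ∑ i, flip f z i := by
  have hsub : parityPolytope d ⊆ cube d ∩ {z | 1 ≤ ∑ i, flip f z i} := by
    refine convexHull_min ?_ ((cube_wellDefined d).2.2.inter ?_)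
    · rintro _ ⟨e, he, rfl⟩
      have hcube : binVec e ∈ cube d := by
        intro i
        rw [binVec_apply]
        have : (e i : ℕ) ≤ 1 := by omega
        exact ⟨by positivity, Nat.cast_le_one.2 this⟩
      refine ⟨hcube, ?_⟩
      have hne : e ≠ f := fun h => Nat.not_even_iff_odd.2 hf (h ▸ he)
      obtain ⟨i, hi⟩ := Function.ne_iff.1 hne
      have hval : flip f (binVec e) i = 1 := by
        rw [flip_apply, binVec_apply]
        generalize e i = s at hi
        generalize f i = t at hi
        fin_cases s <;> fin_cases t <;> simp_all
      have := Finset.single_le_sum (f := fun i => flip f (binVec e) i)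
        (fun j _ => (flip_mem_cube f hcube j).1) (Finset.mem_univ i)
      simpa [hval] using this
    · intro x hx y hy a b ha hb hab
      simp only [Set.mem_ofPred_eq] at hx hy ⊢
      simp only [flip_convexCombo f x y hab, PiLp.add_apply, PiLp.smul_apply, smul_eq_mul,
        Finset.sum_add_distrib, ← Finset.mul_sum]
      nlinarith
  exact hsub hz

/-- If `u` lies in the cube, has coordinate sum at least one and pairwise coordinate sums at most
one, then every odd flip of `u` lies in the parity polytope. -/
theorem flip_mem_parityPolytope {f : Fin d → Fin 2} (hf : Odd (weight f))
    {u : EuclideanSpace ℝ (Fin d)} (hu : u ∈ cube d) (hsum : 1 ≤ ∑ i, u i)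
    (hpair : ∀ i k, i ≠ k → u i + u k ≤ 1) : flip f u ∈ parityPolytope d := by
  by_contra hx
  obtain ⟨-, hcl, hco⟩ := parityPolytope_wellDefined d
  obtain ⟨L, r, hL, hr⟩ := geometric_hahn_banach_closed_point hco hcl hx
  obtain ⟨x, hxdef⟩ : ∃ x, x = flip f u := ⟨_, rfl⟩
  rw [← hxdef] at hx hr
  have hxc : x ∈ cube d := hxdef ▸ flip_mem_cube f hu
  obtain ⟨c, hc⟩ : ∃ c : Fin d → ℝ, ∀ z : EuclideanSpace ℝ (Fin d), L z = ∑ i, c i * z i := by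
    refine ⟨fun i => ((InnerProductSpace.toDual ℝ _).symm L) i, fun z => ?_⟩
    rw [← InnerProductSpace.toDual_symm_apply, PiLp.inner_apply]
    exact Finset.sum_congr rfl fun i _ => by simp [mul_comm]
  have hvert : ∀ e : Fin d → Fin 2, Even (weight e) →
      ∑ i, c i * ((e i : ℕ) - x i : ℝ) < 0 := by
    intro e he
    have h := (hL _ (subset_convexHull ℝ _ ⟨e, he, rfl⟩)).trans hr
    rw [hc, hc] at h
    simp only [mul_sub, Finset.sum_sub_distrib]
    simpa [binVec_apply] using h
  -- The cube vertex maximizing the separating functional `L`. If it is even, it already contradicts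
  -- separation.
  let b : Fin d → Fin 2 := fun i => if 0 < c i then 1 else 0
  have hbc : ∀ i, c i * ((b i : ℕ) - x i : ℝ) = |c i| * flip b x i := by
    intro i
    rw [flip_apply]
    by_cases h : 0 < c i
    · simp [b, h, abs_of_pos h]
    · simp [b, h, abs_of_nonpos (not_lt.1 h)]
  rcases Nat.even_or_odd (weight b) with hb | hb
  · refine absurd (hvert b hb) (not_lt.2 (Finset.sum_nonneg fun i _ => ?_))
    rw [hbc]
    exact mul_nonneg (abs_nonneg _) (flip_mem_cube b hxc i).1
  -- If `b ≠ f`, both being odd, they differ at some `i ≠ k`, which contribute `(1 - u i) + (1 - u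
  -- k) ≥ 1`.
  · have hone : 1 ≤ ∑ i, flip b x i := by
      by_cases hbf : b = f
      · rwa [hbf, hxdef, flip_flip]
      · obtain ⟨i, k, hik, hi, hk⟩ := exists_two_ne_of_odd hb hf hbf
        have h2 := Finset.add_le_sum (f := fun j => flip b x j)
          (fun j _ => (flip_mem_cube b hxc j).1) (Finset.mem_univ i) (Finset.mem_univ k) hik
        simp only [flip_apply_of_ne hi, flip_apply_of_ne hk, hxdef, flip_flip] at h2
        rw [hxdef]
        linarith [hpair i k hik]
    have hd : Nonempty (Fin d) := by
      by_contra hemp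
      rw [not_nonempty_iff] at hemp
      norm_num at hone
    -- The cheapest parity repair of `b` loses `|c k|`, which `hone` shows is at most the lead of
    -- `b` over `x`.
    obtain ⟨k, hk⟩ := Finite.exists_min fun i => |c i|
    have hlt := hvert _ ((even_weight_update b k).2 hb)
    have hk1 : c k * (((1 - b k : Fin 2) : ℕ) - (b k : ℕ) : ℝ) = -|c k| := by
      by_cases h : 0 < c k
      · simp [b, h, abs_of_pos h]
      · simp [b, h, abs_of_nonpos (not_lt.1 h)]
    have hsplit : ∑ i, c i * ((Function.update b k (1 - b k) i : ℕ) - x i : ℝ) =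
        ∑ i, |c i| * flip b x i - |c k| := by
      rw [sub_eq_add_neg (∑ i, _), ← hk1, ← Finset.add_sum_erase _ _ (Finset.mem_univ k),
        ← Finset.add_sum_erase _ (fun i => |c i| * flip b x i) (Finset.mem_univ k),
        Function.update_self, ← hbc]
      rw [Finset.sum_congr rfl (g := fun i => |c i| * flip b x i) fun i hi => by
        rw [Function.update_of_ne (Finset.ne_of_mem_erase hi), hbc]]
      ring
    have hge : |c k| * ∑ i, flip b x i ≤ ∑ i, |c i| * flip b x i := by
      rw [Finset.mul_sum]
      exact Finset.sum_le_sum fun i _ =>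
        mul_le_mul_of_nonneg_right (hk i) (flip_mem_cube b hxc i).1
    nlinarith [abs_nonneg (c k)]

/-! ### The vector chosen by the algorithm -/

theorem IsFacetVector.odd_weight {v : EuclideanSpace ℝ (Fin d)} {f : Fin d → Fin 2}
    (hf : IsFacetVector v f) : Odd (weight f) := by
  rcases hf with ⟨h, rfl⟩ | ⟨h, j, -, rfl⟩
  · exact h
  · rw [← Nat.not_even_iff_odd, even_weight_update, Nat.not_odd_iff_even]
    exact h

theorem flip_threshold_apply (x : EuclideanSpace ℝ (Fin d)) (i : Fin d) :
    flip (threshold x) x i = 1 / 2 - |1 / 2 - x i| := by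
  rw [flip_apply, threshold]
  by_cases h : x i > 1 / 2
  · rw [abs_of_neg (by linarith)]
    simp only [h, if_true]
    ring
  · rw [abs_of_nonneg (by linarith)]
    simp only [h, if_false, Fin.zero_eq_one_iff]
    norm_num

/-- Thresholding puts every flipped coordinate at or below 1/2. Only the repaired index `j` may
exceed it, by the least distance to 1/2, so any other coordinate compensates. -/
theorem IsFacetVector.pair_sum_le_one {v : EuclideanSpace ℝ (Fin d)} {f : Fin d → Fin 2}
    (hf : IsFacetVector v f) {i k : Fin d} (hik : i ≠ k) :
    flip f (proj (cube d) v) i + flip f (proj (cube d) v) k ≤ 1 := by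
  have habs := fun i => abs_nonneg (1 / 2 - proj (cube d) v i)
  rcases hf with ⟨-, rfl⟩ | ⟨-, j, hj, rfl⟩
  · rw [flip_threshold_apply, flip_threshold_apply]
    linarith [habs i, habs k]
  · set x := proj (cube d) v
    set g := Function.update (threshold x) j (1 - threshold x j) with hg
    have hne : ∀ l, l ≠ j → flip g x l = 1 / 2 - |1 / 2 - x l| := by
      intro l hl
      rw [← flip_threshold_apply, flip_apply, flip_apply, hg, Function.update_of_ne hl]
    have hself : flip g x j = 1 / 2 + |1 / 2 - x j| := by
      have : g j ≠ threshold x j := by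
        rw [hg, Function.update_self]
        generalize threshold x j = s
        revert s; decide
      rw [flip_apply_of_ne this, flip_threshold_apply]
      ring
    by_cases hi : i = j
    · subst hi
      rw [hself, hne k hik.symm]
      linarith [hj k]
    · by_cases hk : k = j
      · subst hk
        rw [hself, hne i hi]
        linarith [hj i]
      · rw [hne i hi, hne k hk]
        linarith [habs i, habs k]

/-! ### Projection onto the simplex -/

/-- If the box projection of `w` has coordinate sum below one, then no point of the cube with
coordinate sum at least one is closer to `w` than the projection of `w` onto the simplex. -/
theorem norm_sub_proj_simplex_le (hd : 0 < d) {w y : EuclideanSpace ℝ (Fin d)}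
    (hw : ∑ i, proj (cube d) w i < 1) (hy : y ∈ cube d) (hysum : 1 ≤ ∑ i, y i) :
    ‖w - proj (simplex d) w‖ ≤ ‖w - y‖ := by
  obtain ⟨h1, h2, h3⟩ := simplex_wellDefined d hd
  have hq : IsProj (simplex d) w (proj (simplex d) w) := (isProj_iff h1 h2 h3 w _).2 rfl
  have hu := isProj_proj_cube w
  set u := proj (cube d) w
  set s := ∑ i, u i
  set m := ∑ i, y i
  have hms : 0 < m - s := by linarith
  -- The segment from `u` to `y` meets the hyperplane of coordinate sum one at parameter `t`.
  -- Convexity of the norm bounds the distance there by that at `y`, since `u` is no farther from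
  -- `w` than `y`.
  obtain ⟨t, ht⟩ : ∃ t, t = (1 - s) / (m - s) := ⟨_, rfl⟩
  have htm : t * (m - s) = 1 - s := by rw [ht]; field_simp
  have ht0 : 0 ≤ t := by rw [ht]; exact div_nonneg (by linarith) hms.le
  have ht1 : t ≤ 1 := by rw [ht, div_le_one hms]; linarith
  have hp : (1 - t) • u + t • y ∈ simplex d := by
    refine ⟨?_, fun i => ?_⟩
    · simp only [PiLp.add_apply, PiLp.smul_apply, smul_eq_mul, Finset.sum_add_distrib,
        ← Finset.mul_sum]
      change (1 - t) * s + t * m = 1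
      linarith
    · simp only [PiLp.add_apply, PiLp.smul_apply, smul_eq_mul]
      exact add_nonneg (mul_nonneg (by linarith) (hu.1 i).1) (mul_nonneg ht0 (hy i).1)
  have huy : ‖w - u‖ ≤ ‖w - y‖ := le_of_sq_le_sq (hu.2 y hy) (norm_nonneg _)
  calc ‖w - proj (simplex d) w‖ ≤ ‖w - ((1 - t) • u + t • y)‖ :=
        le_of_sq_le_sq (hq.2 _ hp) (norm_nonneg _)
    _ = ‖(1 - t) • (w - u) + t • (w - y)‖ := by congr 1; module
    _ ≤ (1 - t) * ‖w - u‖ + t * ‖w - y‖ := by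
        refine (norm_add_le _ _).trans_eq ?_
        rw [norm_smul, norm_smul, Real.norm_of_nonneg ht0, Real.norm_of_nonneg (sub_nonneg.2 ht1)]
    _ ≤ ‖w - y‖ := by nlinarith

theorem simplex_subset_cube : simplex d ⊆ cube d := fun q hq i =>
  ⟨hq.2 i, hq.1 ▸ Finset.single_le_sum (f := fun i => q i) (fun j _ => hq.2 j) (Finset.mem_univ i)⟩

theorem flip_simplex_mem_parityPolytope {f : Fin d → Fin 2} (hf : Odd (weight f))
    {q : EuclideanSpace ℝ (Fin d)} (hq : q ∈ simplex d) : flip f q ∈ parityPolytope d :=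
  flip_mem_parityPolytope hf (simplex_subset_cube hq) hq.1.ge fun i k hik =>
    hq.1 ▸ Finset.add_le_sum (f := fun i => q i) (fun j _ => hq.2 j) (Finset.mem_univ i)
      (Finset.mem_univ k) hik

theorem pos_of_odd_weight {f : Fin d → Fin 2} (hf : Odd (weight f)) : 0 < d := by
  rcases Nat.eq_zero_or_pos d with rfl | h
  · simp [weight] at hf
  · exact h

end ParityPolytope

theorem theorem2 (d : ℕ) (v : EuclideanSpace ℝ (Fin d)) (f : Fin d → Fin 2)
    (hv : ParityPolytope.proj (ParityPolytope.cube d) v ∉ ParityPolytope.parityPolytope d)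
    (hf : ParityPolytope.IsFacetVector v f) :
    ParityPolytope.proj (ParityPolytope.parityPolytope d) v =
        ParityPolytope.flip f
          (ParityPolytope.proj (ParityPolytope.simplex d) (ParityPolytope.flip f v)) ∧
      ParityPolytope.algorithmOutput v f =
        ParityPolytope.proj (ParityPolytope.parityPolytope d) v := by
  open ParityPolytope in
  have hodd := hf.odd_weight
  have hlt : ∑ i, proj (cube d) (ParityPolytope.flip f v) i < 1 := by
    by_contra! hge
    rw [proj_cube_flip] at hge
    have hmem := flip_mem_parityPolytope hodd (flip_mem_cube f (isProj_proj_cube v).1) hge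
      fun i k hik => hf.pair_sum_le_one hik
    rw [ParityPolytope.flip_flip] at hmem
    exact hv hmem
  have hd := pos_of_odd_weight hodd
  obtain ⟨s1, s2, s3⟩ := simplex_wellDefined d hd
  obtain ⟨p1, p2, p3⟩ := parityPolytope_wellDefined d
  have hproj : proj (parityPolytope d) v =
      ParityPolytope.flip f (proj (simplex d) (ParityPolytope.flip f v)) := by
    refine (isProj_iff p1 p2 p3 _ _).1 ⟨flip_simplex_mem_parityPolytope hodd
      ((isProj_iff s1 s2 s3 _ _).2 rfl).1, fun z hz => ?_⟩
    obtain ⟨hzc, hzs⟩ := one_le_sum_flip_of_mem_parityPolytope hodd hz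
    have h := norm_sub_proj_simplex_le hd hlt (flip_mem_cube f hzc) hzs
    rw [norm_flip_sub_flip, ← norm_flip_sub_flip f, ParityPolytope.flip_flip] at h
    gcongr
  refine ⟨hproj, ?_⟩
  rw [hproj, algorithmOutput, if_neg (not_le.2 hlt)]
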